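/- Let $G$ be a compact (Hausdorff) group with normalized Haar measure $dx$ and let $n\in\mathbb{N}$. Let $V^n(G)=C(G)\otimes^h\cdots\otimes^h C(G)$ be the $(n+1)$-fold Haagerup tensor product, that is, the completion of the algebraic tensor product of $n+1$ copies of $C(G)$ (the linear span in $C(G^{n+1})$ of the functions $f_1(x_1)\cdots f_{n+1}(x_{n+1})$) in the norm $$\|u\|_V=\inf\{\|a_1\|\,\|a_2\|\cdots\|a_{n+1}\| : u=a_1\odot a_2\odot\cdots\odot a_{n+1}\},$$ where $a_1$ is a finite row, $a_2,\dots,a_n$ are finite matrices and $a_{n+1}$ is a finite column of matching sizes with entries in $C(G)$ (for $n=0$ one has $V^0(G)=C(G)$ with the uniform norm), $u=a_1\odot\cdots\odot a_{n+1}$ means $u(x_1,\dots,x_{n+1})=a_1(x_1)a_2(x_2)\cdots a_{n+1}(x_{n+1})$ (a product of scalar matrices), and $\|a\|=\sup_{x\in G}\|a(x)\|_{\rm op}$. With pointwise multiplication $V^n(G)$ is a commutative Banach algebra, and each $\omega\in V^n(G)$ defines a continuous function $\omega(x_1,\dots,x_{n+1})$ on $G^{n+1}$ by continuous extension. Let $$V^n_{inv}(G)=\{\omega\in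 V^n(G):\ \omega(x_1x,\dots,x_{n+1}x)=\omega(x_1,\dots,x_{n+1})\ \ \forall\, x,x_1,\dots,x_{n+1}\in G\}.$$ Then the formula $$P^n\omega(x_1,\dots,x_{n+1})=\int_G\omega(x_1x,\dots,x_{n+1}x)\,dx$$ determines a well-defined bounded linear map $P^n:V^n(G)\to V^n(G)$: for every $\omega\in V^n(G)$ there is exactly one element $P^n\omega$ of $V^n(G)$ with these values. It is a contractive projection onto $V^n_{inv}(G)$, i.e. $\|P^n\omega\|_V\le\|\omega\|_V$ and $P^n(P^n\omega)=P^n\omega$ for all $\omega$, and the range of $P^n$ is $V^n_{inv}(G)$; and it is a $V^n_{inv}(G)$-module map, i.e. $P^n(v\,\omega)=v\,P^n\omega$ for all $v\in V^n_{inv}(G)$ and $\omega\in V^n(G)$. -/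

import Mathlib

open MeasureTheory
open scoped Matrix Kronecker Matrix.Norms.L2Operator

set_option linter.unusedSectionVars false

noncomputable section

namespace Varopoulos

/-! ### Elementary facts on matrices used to verify the algebra axioms -/

section Aux

variable {ι κ : Type} [Fintype ι] [Fintype κ]

/-- Squared Euclidean length of a complex vector. -/
def nsq (v : ι → ℂ) : ℝ := ∑ i, ‖v i‖ ^ 2

theorem nsq_nonneg (v : ι → ℂ) : 0 ≤ nsq v := Finset.sum_nonneg fun _ _ => by positivity

theorem nsq_eq (v : ι → ℂ) : nsq v = ‖(WithLp.toLp 2 v : EuclideanSpace ℂ ι)‖ ^ 2 := by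
  rw [EuclideanSpace.norm_sq_eq]; rfl

theorem nsq_smul (z : ℂ) (v : ι → ℂ) : nsq (z • v) = ‖z‖ ^ 2 * nsq v := by
  simp [nsq, Finset.mul_sum, mul_pow]

theorem nsq_mulVec_le [DecidableEq ι] (M : Matrix κ ι ℂ) (v : ι → ℂ) :
    nsq (M *ᵥ v) ≤ ‖M‖ ^ 2 * nsq v := by
  rw [nsq_eq, nsq_eq, ← mul_pow]
  exact pow_le_pow_left₀ (norm_nonneg _) (Matrix.l2_opNorm_mulVec M (WithLp.toLp 2 v)) 2

theorem opNorm_le [DecidableEq ι] (M : Matrix κ ι ℂ) {C : ℝ} (hC : 0 ≤ C)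
    (h : ∀ v, nsq (M *ᵥ v) ≤ C ^ 2 * nsq v) : ‖M‖ ≤ C := by
  rw [Matrix.l2_opNorm_def]
  refine ContinuousLinearMap.opNorm_le_bound _ hC fun v => ?_
  have h1 := h (WithLp.ofLp v)
  rw [nsq_eq, nsq_eq, ← mul_pow] at h1
  exact le_of_sq_le_sq h1 (by positivity)

theorem norm_dotProduct_sq_le (a b : ι → ℂ) : ‖a ⬝ᵥ b‖ ^ 2 ≤ nsq a * nsq b := by
  have h1 : ‖a ⬝ᵥ b‖ ≤ ∑ i, ‖a i‖ * ‖b i‖ := by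
    refine (norm_sum_le _ _).trans (le_of_eq ?_)
    simp
  calc ‖a ⬝ᵥ b‖ ^ 2 ≤ (∑ i, ‖a i‖ * ‖b i‖) ^ 2 := pow_le_pow_left₀ (norm_nonneg _) h1 2
    _ ≤ _ := Finset.sum_mul_sq_le_sq_mul_sq _ _ _

/-- Contractive square matrices. -/
def Contr (M : Matrix ι ι ℂ) : Prop := ∀ v, nsq (M *ᵥ v) ≤ nsq v

theorem Contr.mul {M N : Matrix ι ι ℂ} (hM : Contr M) (hN : Contr N) : Contr (M * N) := fun v => by
  rw [← Matrix.mulVec_mulVec]; exact (hM _).trans (hN _)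

theorem Contr.one [DecidableEq ι] : Contr (1 : Matrix ι ι ℂ) := fun v => by simp

theorem Contr.norm_le [DecidableEq ι] {M : Matrix ι ι ℂ} (h : Contr M) : ‖M‖ ≤ 1 :=
  opNorm_le M zero_le_one fun v => by rw [one_pow, one_mul]; exact h v

theorem Contr.of_norm_le [DecidableEq ι] {M : Matrix ι ι ℂ} (h : ‖M‖ ≤ 1) : Contr M := fun v =>
  (nsq_mulVec_le M v).trans
    (mul_le_of_le_one_left (nsq_nonneg v) (pow_le_one₀ (norm_nonneg _) h))

theorem Contr.list_prod [DecidableEq ι] (l : List (Matrix ι ι ℂ)) (h : ∀ M ∈ l, Contr M) :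
    Contr l.prod := by
  induction l with
  | nil => exact Contr.one
  | cons M l ih =>
    rw [List.prod_cons]
    exact (h M (by simp)).mul (ih fun N hN => h N (by simp [hN]))

theorem Contr.fromBlocks {M : Matrix ι ι ℂ} {N : Matrix κ κ ℂ} (hM : Contr M) (hN : Contr N) :
    Contr (Matrix.fromBlocks M 0 0 N) := fun v => by
  have h1 := hM (v ∘ Sum.inl)
  have h2 := hN (v ∘ Sum.inr)
  rw [Matrix.fromBlocks_mulVec]
  simp only [nsq, Fintype.sum_sum_type, Sum.elim_inl, Sum.elim_inr, Matrix.zero_mulVec, add_zero,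
    zero_add, Function.comp_apply] at *
  linarith

theorem Contr.kronecker {M : Matrix ι ι ℂ} {N : Matrix κ κ ℂ} (hM : Contr M) (hN : Contr N) :
    Contr (M ⊗ₖ N) := fun v => by
  have e : ∀ i j, ((M ⊗ₖ N) *ᵥ v) (i, j) = (M *ᵥ fun k => (N *ᵥ fun l => v (k, l)) j) i := by
    intro i j
    simp only [Matrix.mulVec, dotProduct, Matrix.kroneckerMap_apply, Fintype.sum_prod_type,
      Finset.mul_sum, mul_assoc]
  calc nsq ((M ⊗ₖ N) *ᵥ v)
      = ∑ j, nsq (M *ᵥ fun k => (N *ᵥ fun l => v (k, l)) j) := by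
        simp only [nsq, Fintype.sum_prod_type_right, e]
    _ ≤ ∑ j, nsq (fun k => (N *ᵥ fun l => v (k, l)) j) := Finset.sum_le_sum fun j _ => hM _
    _ = ∑ k, nsq (N *ᵥ fun l => v (k, l)) := by
        simp only [nsq]; exact Finset.sum_comm
    _ ≤ ∑ k, nsq (fun l => v (k, l)) := Finset.sum_le_sum fun k _ => hN _
    _ = nsq v := by simp only [nsq, Fintype.sum_prod_type]

theorem prod_ofFn_fromBlocks [DecidableEq ι] [DecidableEq κ] (m : ℕ)
    (X : Fin m → Matrix ι ι ℂ) (Y : Fin m → Matrix κ κ ℂ) :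
    (List.ofFn fun k => Matrix.fromBlocks (X k) 0 0 (Y k)).prod
      = Matrix.fromBlocks (List.ofFn X).prod 0 0 (List.ofFn Y).prod := by
  induction m with
  | zero => simp
  | succ m ih => simp [List.ofFn_succ, ih, Matrix.fromBlocks_multiply]

theorem prod_ofFn_kronecker [DecidableEq ι] [DecidableEq κ] (m : ℕ)
    (X : Fin m → Matrix ι ι ℂ) (Y : Fin m → Matrix κ κ ℂ) :
    (List.ofFn fun k => X k ⊗ₖ Y k).prod = (List.ofFn X).prod ⊗ₖ (List.ofFn Y).prod := by
  induction m with
  | zero => simp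
  | succ m ih => simp only [List.ofFn_succ, List.prod_cons, ih, Matrix.mul_kronecker_mul]

theorem prod_ofFn_smul [DecidableEq ι] (m : ℕ) (z : Fin m → ℂ) (X : Fin m → Matrix ι ι ℂ) :
    (List.ofFn fun k => z k • X k).prod = (∏ k, z k) • (List.ofFn X).prod := by
  induction m with
  | zero => simp
  | succ m ih => simp [List.ofFn_succ, ih, Fin.prod_univ_succ, smul_smul, mul_comm]

theorem prod_ofFn_ends {M : Type*} [Monoid M] (n : ℕ) (L R : M) (X : Fin (n + 1) → M) :
    (List.ofFn fun k => (if k = 0 then L else 1) * (X k * (if k = Fin.last n then R else 1))).prod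
      = L * ((List.ofFn X).prod * R) := by
  have h1 : ∀ Z : Fin (n + 1) → M,
      (List.ofFn fun k => (if k = 0 then L else 1) * Z k).prod = L * (List.ofFn Z).prod := by
    intro Z
    simp [List.ofFn_succ, mul_assoc]
  rw [h1]
  congr 1
  rw [List.ofFn_succ', List.ofFn_succ']
  simp [List.concat_eq_append, Fin.castSucc_ne_last, mul_assoc]

end Aux

/-! ### The Haagerup norm -/

section Haagerup

variable {n : ℕ} {G : Type*} [TopologicalSpace G] [CompactSpace G]

/-- `u = x₀ ⊙ x₁ ⊙ ⋯ ⊙ xₙ` with `xₖ` a matrix over `C(G)`, regarded as a function on `G ^ (n+1)`.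
A matrix over `C(G)` is a continuous matrix-valued function, and its norm in the operator space
structure of the C*-algebra `C(G)` is the supremum over `G` of the operator norm, which is the
norm of `C(G, Matrix _ _ ℂ)` (operator norm on `ℓ²` on matrices).
The Haagerup product of a row `x₀`, rectangular matrices `x₁, …, xₙ₋₁` and a column `xₙ` is the
`(0,0)` entry of the product below once all of them are padded with zeros to square matrices,
which does not change their norms; conversely only the zeroth row of `x₀` and the zeroth column of
`xₙ` enter the formula. -/
def IsHaagerupFactorization (u : C(Fin (n + 1) → G, ℂ)) (r : ℕ)
    (x : Fin (n + 1) → C(G, Matrix (Fin (r + 1)) (Fin (r + 1)) ℂ)) : Prop :=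
  ∀ t : Fin (n + 1) → G, u t = (List.ofFn fun k => x k (t k)).prod 0 0

/-- The Haagerup tensor norm `‖u‖_h = inf ‖x₀‖ ‖x₁‖ ⋯ ‖xₙ‖` over all finite factorizations
`u = x₀ ⊙ x₁ ⊙ ⋯ ⊙ xₙ`. -/
def haagerupNorm (u : C(Fin (n + 1) → G, ℂ)) : ℝ :=
  sInf {c : ℝ | ∃ (r : ℕ) (x : Fin (n + 1) → C(G, Matrix (Fin (r + 1)) (Fin (r + 1)) ℂ)),
    IsHaagerupFactorization u r x ∧ c = ∏ k, ‖x k‖}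

/-- Auxiliary: a convenient form of `‖u‖_h ≤ c` with attained bound. -/
def HBound (u : C(Fin (n + 1) → G, ℂ)) (c : ℝ) : Prop :=
  ∃ (ι : Type) (_ : Fintype ι) (_ : DecidableEq ι) (_ : Nonempty ι) (a b : ι → ℂ)
    (x : Fin (n + 1) → C(G, Matrix ι ι ℂ)),
    (∀ k s, Contr (x k s)) ∧ nsq a ≤ c ∧ nsq b ≤ c ∧
      ∀ t, u t = a ⬝ᵥ ((List.ofFn fun k => x k (t k)).prod *ᵥ b)

theorem HBound.nonneg {u : C(Fin (n + 1) → G, ℂ)} {c : ℝ} (h : HBound u c) : 0 ≤ c := by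
  obtain ⟨ι, _, _, _, a, b, x, -, ha, -⟩ := h
  exact (nsq_nonneg a).trans ha

theorem HBound.norm_apply_le {u : C(Fin (n + 1) → G, ℂ)} {c : ℝ} (h : HBound u c)
    (t : Fin (n + 1) → G) : ‖u t‖ ≤ c := by
  have hc := h.nonneg
  obtain ⟨ι, _, _, _, a, b, x, hx, ha, hb, hu⟩ := h
  rw [hu t]
  refine le_of_sq_le_sq ?_ hc
  refine (norm_dotProduct_sq_le _ _).trans ?_
  rw [sq]
  refine mul_le_mul ha (((Contr.list_prod _ ?_) b).trans hb) (nsq_nonneg _) hc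
  intro M hM
  obtain ⟨k, rfl⟩ := (List.mem_ofFn' _ _).1 hM
  exact hx _ _

theorem HBound.zero : HBound (0 : C(Fin (n + 1) → G, ℂ)) 0 :=
  ⟨Unit, inferInstance, inferInstance, inferInstance, 0, 0, fun _ => ContinuousMap.const _ 1,
    fun _ _ => Contr.one, by simp [nsq], by simp [nsq], by simp⟩

theorem HBound.add {u v : C(Fin (n + 1) → G, ℂ)} {c d : ℝ} (hu : HBound u c) (hv : HBound v d) :
    HBound (u + v) (c + d) := by
  obtain ⟨ι, _, _, _, a, b, x, hx, ha, hb, hu⟩ := hu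
  obtain ⟨κ, _, _, _, a', b', y, hy, ha', hb', hv⟩ := hv
  refine ⟨ι ⊕ κ, inferInstance, inferInstance, inferInstance, Sum.elim a a', Sum.elim b b',
    fun k => ⟨fun s => Matrix.fromBlocks (x k s) 0 0 (y k s), ?_⟩, ?_, ?_, ?_, ?_⟩
  · exact Continuous.matrix_fromBlocks (x k).continuous continuous_const continuous_const
      (y k).continuous
  · exact fun k s => (hx k s).fromBlocks (hy k s)
  · simpa [nsq, Fintype.sum_sum_type] using add_le_add ha ha'
  · simpa [nsq, Fintype.sum_sum_type] using add_le_add hb hb'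
  · intro t
    simp only [ContinuousMap.add_apply, hu t, hv t, ContinuousMap.coe_mk]
    rw [prod_ofFn_fromBlocks, Matrix.fromBlocks_mulVec]
    simp [dotProduct, Fintype.sum_sum_type]

theorem HBound.mul {u v : C(Fin (n + 1) → G, ℂ)} {c d : ℝ} (hu : HBound u c) (hv : HBound v d) :
    HBound (u * v) (c * d) := by
  have hc := hu.nonneg
  obtain ⟨ι, _, _, _, a, b, x, hx, ha, hb, hu⟩ := hu
  obtain ⟨κ, _, _, _, a', b', y, hy, ha', hb', hv⟩ := hv
  have key : ∀ (p : ι → ℂ) (q : κ → ℂ), nsq (fun i : ι × κ => p i.1 * q i.2) = nsq p * nsq q := by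
    intro p q
    simp [nsq, Fintype.sum_prod_type, Finset.sum_mul_sum, mul_pow]
  refine ⟨ι × κ, inferInstance, inferInstance, inferInstance, fun i => a i.1 * a' i.2,
    fun i => b i.1 * b' i.2, fun k => ⟨fun s => x k s ⊗ₖ y k s, ?_⟩, ?_, ?_, ?_, ?_⟩
  · exact continuous_matrix fun i j =>
      (((x k).continuous.matrix_elem i.1 j.1).mul ((y k).continuous.matrix_elem i.2 j.2))
  · exact fun k s => (hx k s).kronecker (hy k s)
  · rw [key]; exact mul_le_mul ha ha' (nsq_nonneg _) hc
  · rw [key]; exact mul_le_mul hb hb' (nsq_nonneg _) hc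
  · intro t
    simp only [ContinuousMap.mul_apply, hu t, hv t, ContinuousMap.coe_mk]
    rw [prod_ofFn_kronecker]
    have e : ∀ (A : Matrix ι ι ℂ) (B : Matrix κ κ ℂ),
        ((A ⊗ₖ B) *ᵥ fun i : ι × κ => b i.1 * b' i.2)
          = fun i : ι × κ => (A *ᵥ b) i.1 * (B *ᵥ b') i.2 := by
      intro A B
      funext i
      simp only [Matrix.mulVec, dotProduct, Fintype.sum_prod_type, Matrix.kroneckerMap_apply,
        Finset.sum_mul_sum]
      exact Finset.sum_congr rfl fun k _ => Finset.sum_congr rfl fun l _ => by ring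
    rw [e]
    simp only [dotProduct, Fintype.sum_prod_type, Finset.sum_mul_sum]
    exact Finset.sum_congr rfl fun k _ => Finset.sum_congr rfl fun l _ => by ring

theorem HBound.smul (z : ℂ) {u : C(Fin (n + 1) → G, ℂ)} {c : ℝ} (hu : HBound u c) :
    HBound (z • u) (‖z‖ * c) := by
  obtain ⟨ι, _, _, _, a, b, x, hx, ha, hb, hu⟩ := hu
  obtain ⟨p, q, hpq, hp, hq⟩ : ∃ p q : ℂ, p * q = z ∧ ‖p‖ ^ 2 = ‖z‖ ∧ ‖q‖ ^ 2 = ‖z‖ := by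
    obtain ⟨p, hp⟩ := IsAlgClosed.exists_eq_mul_self z
    exact ⟨p, p, hp.symm, by rw [hp, norm_mul, sq], by rw [hp, norm_mul, sq]⟩
  refine ⟨ι, inferInstance, inferInstance, inferInstance, p • a, q • b, x, hx, ?_, ?_, ?_⟩
  · rw [nsq_smul, hp]; exact mul_le_mul_of_nonneg_left ha (norm_nonneg _)
  · rw [nsq_smul, hq]; exact mul_le_mul_of_nonneg_left hb (norm_nonneg _)
  · intro t
    simp only [ContinuousMap.smul_apply, hu t, Matrix.mulVec_smul, smul_dotProduct,
      dotProduct_smul, smul_smul]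
    rw [mul_comm q p, hpq]

/-- The elementary function `t ↦ f (t i)`, i.e. `1 ⊗ ⋯ ⊗ f ⊗ ⋯ ⊗ 1`. -/
def coordFun (i : Fin (n + 1)) (f : C(G, ℂ)) : C(Fin (n + 1) → G, ℂ) :=
  f.comp ⟨fun t => t i, continuous_apply i⟩

theorem prod_ofFn_single {M : Type*} [Monoid M] (m : ℕ) (i : Fin m) (z : M) :
    (List.ofFn fun k => if k = i then z else 1).prod = z := by
  induction m with
  | zero => exact i.elim0
  | succ m ih =>
    rw [List.ofFn_succ, List.prod_cons]
    refine Fin.cases ?_ (fun j => ?_) i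
    · simp
    · have : (0 : Fin (m + 1)) ≠ j.succ := (Fin.succ_ne_zero j).symm
      simp [this, ih]

theorem HBound.one : HBound (1 : C(Fin (n + 1) → G, ℂ)) 1 :=
  ⟨Unit, inferInstance, inferInstance, inferInstance, 1, 1, fun _ => ContinuousMap.const _ 1,
    fun _ _ => Contr.one, by simp [nsq], by simp [nsq], by simp⟩

theorem HBound.of_contr_coord (i : Fin (n + 1)) (f : C(G, ℂ)) (hf : ∀ s, ‖f s‖ ≤ 1) :
    HBound (coordFun i f) 1 := by
  refine ⟨Unit, inferInstance, inferInstance, inferInstance, 1, 1,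
    fun k => if k = i then ⟨fun s => f s • (1 : Matrix Unit Unit ℂ), by fun_prop⟩
      else ContinuousMap.const _ 1, ?_, by simp [nsq], by simp [nsq], ?_⟩
  · intro k s
    by_cases hk : k = i
    · simp only [hk, if_true, ContinuousMap.coe_mk]
      intro v
      rw [Matrix.smul_mulVec, Matrix.one_mulVec, nsq_smul]
      exact mul_le_of_le_one_left (nsq_nonneg v) (pow_le_one₀ (norm_nonneg _) (hf s))
    · simp only [hk, if_false, ContinuousMap.const_apply]
      exact Contr.one
  · intro t
    have : (fun k => (if k = i then (⟨fun s => f s • (1 : Matrix Unit Unit ℂ), by fun_prop⟩ :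
        C(G, Matrix Unit Unit ℂ)) else ContinuousMap.const _ 1) (t k))
        = fun k => if k = i then f (t i) • (1 : Matrix Unit Unit ℂ) else 1 := by
      funext k
      by_cases hk : k = i
      · subst hk; simp
      · simp [hk]
    rw [this, prod_ofFn_single]
    simp [coordFun, dotProduct, Matrix.smul_mulVec]

theorem HBound.coord (i : Fin (n + 1)) (f : C(G, ℂ)) : ∃ c, HBound (coordFun i f) c := by
  set N : ℝ := ‖f‖ + 1 with hN
  have hN0 : 0 < N := by positivity
  have h1 : ∀ s, ‖(((N⁻¹ : ℝ) : ℂ) • f) s‖ ≤ 1 := by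
    intro s
    have h1 : ‖f s‖ ≤ N := (f.norm_coe_le_norm s).trans (by simp [hN])
    rw [ContinuousMap.smul_apply, norm_smul, Complex.norm_of_nonneg (by positivity),
      inv_mul_le_iff₀ hN0, mul_one]
    exact h1
  have h := HBound.smul (N : ℂ) (HBound.of_contr_coord i _ h1)
  have e : (N : ℂ) • coordFun i (((N⁻¹ : ℝ) : ℂ) • f) = coordFun i f := by
    ext t
    have : (N : ℂ) ≠ 0 := by exact_mod_cast hN0.ne'
    simp [coordFun, this]
  rw [e] at h
  exact ⟨_, h⟩

theorem HBound.reindex {u : C(Fin (n + 1) → G, ℂ)} {c : ℝ} (h : HBound u c) :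
    ∃ (r : ℕ) (a b : Fin (r + 1) → ℂ)
      (x : Fin (n + 1) → C(G, Matrix (Fin (r + 1)) (Fin (r + 1)) ℂ)),
      (∀ k s, Contr (x k s)) ∧ nsq a ≤ c ∧ nsq b ≤ c ∧
      ∀ t, u t = a ⬝ᵥ ((List.ofFn fun k => x k (t k)).prod *ᵥ b) := by
  obtain ⟨ι, _, _, _, a, b, x, hx, ha, hb, hu⟩ := h
  obtain ⟨r, hr⟩ : ∃ r, Fintype.card ι = r + 1 := Nat.exists_eq_succ_of_ne_zero Fintype.card_ne_zero
  let e : ι ≃ Fin (r + 1) := Fintype.equivFinOfCardEq hr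
  have hn : ∀ v : ι → ℂ, nsq (v ∘ e.symm) = nsq v := fun v =>
    Equiv.sum_comp e.symm fun i => ‖v i‖ ^ 2
  have hmv : ∀ (M : Matrix ι ι ℂ) (v : ι → ℂ),
      (Matrix.reindexRingEquiv ℂ e M) *ᵥ (v ∘ e.symm) = (M *ᵥ v) ∘ e.symm := by
    intro M v
    funext i
    simp only [Matrix.mulVec, dotProduct, Function.comp_apply]
    exact Equiv.sum_comp e.symm fun j => M (e.symm i) j * v j
  refine ⟨r, a ∘ e.symm, b ∘ e.symm,
    fun k => ⟨fun s => Matrix.reindexRingEquiv ℂ e (x k s), ?_⟩, ?_, ?_, ?_, ?_⟩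
  · exact continuous_matrix fun i j => (x k).continuous.matrix_elem (e.symm i) (e.symm j)
  · intro k s v
    have := hx k s (v ∘ e)
    rw [← hn, ← hn (v ∘ e), ← hmv] at this
    simpa [Function.comp_assoc] using this
  · rw [hn]; exact ha
  · rw [hn]; exact hb
  · intro t
    have h1 : (List.ofFn fun k => Matrix.reindexRingEquiv ℂ e (x k (t k))).prod
        = Matrix.reindexRingEquiv ℂ e (List.ofFn fun k => x k (t k)).prod := by
      rw [map_list_prod, List.map_ofFn]; rfl
    simp only [ContinuousMap.coe_mk]
    rw [h1, hmv, hu t]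
    simp only [dotProduct, Function.comp_apply]
    exact (Equiv.sum_comp e.symm fun i =>
      a i * ((List.ofFn fun k => x k (t k)).prod *ᵥ b) i).symm

theorem HBound.exists_factorization {u : C(Fin (n + 1) → G, ℂ)} {c : ℝ} (h : HBound u c) :
    ∃ (r : ℕ) (x : Fin (n + 1) → C(G, Matrix (Fin (r + 1)) (Fin (r + 1)) ℂ)),
      IsHaagerupFactorization u r x ∧ ∏ k, ‖x k‖ ≤ c := by
  have hc := h.nonneg
  obtain ⟨r, a, b, x, hx, ha, hb, hu⟩ := h.reindex
  let L : Matrix (Fin (r + 1)) (Fin (r + 1)) ℂ := Matrix.of fun i j => if i = 0 then a j else 0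
  let R : Matrix (Fin (r + 1)) (Fin (r + 1)) ℂ := Matrix.of fun i j => if j = 0 then b i else 0
  have hs : 0 ≤ Real.sqrt c := Real.sqrt_nonneg c
  have hL : ‖L‖ ≤ Real.sqrt c := by
    refine opNorm_le _ hs fun v => ?_
    rw [Real.sq_sqrt hc]
    have e : L *ᵥ v = Pi.single 0 (a ⬝ᵥ v) := by
      funext i
      by_cases hi : i = 0
      · subst hi; simp [L, Matrix.mulVec, dotProduct]
      · simp [L, Matrix.mulVec, dotProduct, hi]
    have e2 : nsq (Pi.single (0 : Fin (r + 1)) (a ⬝ᵥ v)) = ‖a ⬝ᵥ v‖ ^ 2 := by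
      rw [nsq, Finset.sum_eq_single 0]
      · simp
      · intro i _ hi; simp [hi]
      · simp
    rw [e, e2]
    exact (norm_dotProduct_sq_le _ _).trans (mul_le_mul_of_nonneg_right ha (nsq_nonneg _))
  have hR : ‖R‖ ≤ Real.sqrt c := by
    refine opNorm_le _ hs fun v => ?_
    rw [Real.sq_sqrt hc]
    have e : R *ᵥ v = v 0 • b := by
      funext i
      simp [R, Matrix.mulVec, dotProduct, mul_comm]
    rw [e, nsq_smul, mul_comm]
    refine mul_le_mul hb ?_ (by positivity) hc
    exact Finset.single_le_sum (f := fun i => ‖v i‖ ^ 2) (fun _ _ => by positivity)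
      (Finset.mem_univ 0)
  let L' : Fin (n + 1) → Matrix (Fin (r + 1)) (Fin (r + 1)) ℂ := fun k => if k = 0 then L else 1
  let R' : Fin (n + 1) → Matrix (Fin (r + 1)) (Fin (r + 1)) ℂ :=
    fun k => if k = Fin.last n then R else 1
  have hone : ‖(1 : Matrix (Fin (r + 1)) (Fin (r + 1)) ℂ)‖ ≤ 1 := Contr.one.norm_le
  have hL' : ∀ k, ‖L' k‖ ≤ if k = 0 then Real.sqrt c else 1 := by
    intro k; by_cases hk : k = 0 <;> simp only [L', hk, if_true, if_false] <;> assumption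
  have hR' : ∀ k, ‖R' k‖ ≤ if k = Fin.last n then Real.sqrt c else 1 := by
    intro k; by_cases hk : k = Fin.last n <;> simp only [R', hk, if_true, if_false] <;> assumption
  refine ⟨r, fun k => ⟨fun s => L' k * (x k s * R' k), ?_⟩, ?_, ?_⟩
  · exact continuous_const.mul ((x k).continuous.mul continuous_const)
  · intro t
    simp only [ContinuousMap.coe_mk, L', R']
    rw [prod_ofFn_ends, hu t]
    simp [L, R, Matrix.mul_apply, Matrix.mulVec, dotProduct]
  · calc _ ≤ ∏ k : Fin (n + 1), ((if k = 0 then Real.sqrt c else 1) *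
          (if k = Fin.last n then Real.sqrt c else 1)) := by
          refine Finset.prod_le_prod (fun _ _ => norm_nonneg _) fun k _ => ?_
          have h0 : (0 : ℝ) ≤ if k = 0 then Real.sqrt c else 1 := by split_ifs <;> positivity
          have h1 : (0 : ℝ) ≤ if k = Fin.last n then Real.sqrt c else 1 := by
            split_ifs <;> positivity
          rw [ContinuousMap.norm_le _ (mul_nonneg h0 h1)]
          intro s
          refine (norm_mul_le _ _).trans (mul_le_mul (hL' k) ?_ (norm_nonneg _) h0)
          refine (norm_mul_le _ _).trans ?_
          calc _ ≤ 1 * _ := mul_le_mul (hx k s).norm_le (hR' k) (norm_nonneg _) zero_le_one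
            _ = _ := one_mul _
      _ = c := by
          rw [Finset.prod_mul_distrib, Finset.prod_ite_eq', Finset.prod_ite_eq']
          simp [Real.mul_self_sqrt hc]

theorem IsHaagerupFactorization.hBound {u : C(Fin (n + 1) → G, ℂ)} {r : ℕ}
    {x : Fin (n + 1) → C(G, Matrix (Fin (r + 1)) (Fin (r + 1)) ℂ)}
    (h : IsHaagerupFactorization u r x) : HBound u (∏ k, ‖x k‖) := by
  have hc : 0 ≤ ∏ k, ‖x k‖ := Finset.prod_nonneg fun _ _ => norm_nonneg _
  by_cases h0 : ∃ k, ‖x k‖ = 0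
  · obtain ⟨k, hk⟩ := h0
    rw [Finset.prod_eq_zero (Finset.mem_univ k) hk]
    have : u = 0 := by
      ext t
      rw [h t, List.prod_eq_zero]
      · rfl
      · refine (List.mem_ofFn' _ _).2 ⟨k, ?_⟩
        simp [norm_eq_zero.1 hk]
    rw [this]
    exact HBound.zero
  push Not at h0
  set c := ∏ k, ‖x k‖ with hcdef
  have e : ∀ t : Fin (n + 1) → G, (List.ofFn fun k => (((‖x k‖⁻¹ : ℝ) : ℂ) • x k) (t k)).prod
      = ((c⁻¹ : ℝ) : ℂ) • (List.ofFn fun k => x k (t k)).prod := by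
    intro t
    simp only [ContinuousMap.smul_apply]
    rw [prod_ofFn_smul, hcdef, ← Finset.prod_inv_distrib]
    push_cast
    rfl
  have hc0 : c ≠ 0 := Finset.prod_ne_zero_iff.2 fun k _ => h0 k
  have hn : nsq (Pi.single (0 : Fin (r + 1)) ((Real.sqrt c : ℝ) : ℂ)) ≤ c := by
    rw [nsq, Finset.sum_eq_single 0]
    · simp [Real.sq_sqrt hc]
    · intro i _ hi; simp [hi]
    · simp
  refine ⟨Fin (r + 1), inferInstance, inferInstance, inferInstance,
    Pi.single 0 ((Real.sqrt c : ℝ) : ℂ), Pi.single 0 ((Real.sqrt c : ℝ) : ℂ),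
    fun k => ((‖x k‖⁻¹ : ℝ) : ℂ) • x k, ?_, hn, hn, ?_⟩
  · intro k s
    refine Contr.of_norm_le ?_
    rw [ContinuousMap.smul_apply, norm_smul, Complex.norm_of_nonneg (by positivity),
      inv_mul_le_iff₀ (lt_of_le_of_ne (norm_nonneg _) (h0 k).symm), mul_one]
    exact (x k).norm_coe_le_norm s
  · intro t
    rw [e t, h t]
    have h2 : ((Real.sqrt c : ℝ) : ℂ) * ((Real.sqrt c : ℝ) : ℂ) = (c : ℂ) := by
      rw [← Complex.ofReal_mul, Real.mul_self_sqrt hc]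
    have h3 : (c : ℂ) ≠ 0 := by exact_mod_cast hc0
    rw [Matrix.smul_mulVec, dotProduct_smul, single_dotProduct, Matrix.mulVec_single]
    simp only [Pi.smul_apply, MulOpposite.smul_eq_mul_unop, MulOpposite.unop_op, smul_eq_mul,
      Matrix.col_apply, Complex.ofReal_inv]
    field_simp
    linear_combination (-(List.ofFn fun k => x k (t k)).prod 0 0) * h2

theorem haagerupNorm_bddBelow (u : C(Fin (n + 1) → G, ℂ)) :
    BddBelow {c : ℝ | ∃ (r : ℕ) (x : Fin (n + 1) → C(G, Matrix (Fin (r + 1)) (Fin (r + 1)) ℂ)),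
      IsHaagerupFactorization u r x ∧ c = ∏ k, ‖x k‖} :=
  ⟨0, by rintro _ ⟨r, x, -, rfl⟩; exact Finset.prod_nonneg fun _ _ => norm_nonneg _⟩

theorem haagerupNorm_nonneg (u : C(Fin (n + 1) → G, ℂ)) : 0 ≤ haagerupNorm u :=
  Real.sInf_nonneg (by rintro _ ⟨r, x, -, rfl⟩; exact Finset.prod_nonneg fun _ _ => norm_nonneg _)

theorem HBound.haagerupNorm_le {u : C(Fin (n + 1) → G, ℂ)} {c : ℝ} (h : HBound u c) :
    haagerupNorm u ≤ c := by
  obtain ⟨r, x, hx, hle⟩ := h.exists_factorization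
  exact (csInf_le (haagerupNorm_bddBelow u) ⟨r, x, hx, rfl⟩).trans hle

theorem exists_hBound_lt {u : C(Fin (n + 1) → G, ℂ)} (h : ∃ c, HBound u c) {d : ℝ}
    (hd : haagerupNorm u < d) : ∃ c < d, HBound u c := by
  obtain ⟨c, hc⟩ := h
  obtain ⟨r, x, hx, -⟩ := hc.exists_factorization
  obtain ⟨_, ⟨r, x, hx, rfl⟩, hlt⟩ := exists_lt_of_csInf_lt (⟨_, r, x, hx, rfl⟩ :
    {c : ℝ | ∃ (r : ℕ) (x : Fin (n + 1) → C(G, Matrix (Fin (r + 1)) (Fin (r + 1)) ℂ)),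
      IsHaagerupFactorization u r x ∧ c = ∏ k, ‖x k‖}.Nonempty) hd
  exact ⟨_, hlt, hx.hBound⟩

end Haagerup

/-! ### The algebraic tensor product and its completion -/

section Algebra

variable (n : ℕ) (G : Type*) [TopologicalSpace G] [CompactSpace G]

/-- The algebraic tensor product `C(G) ⊗ ⋯ ⊗ C(G)` (`n + 1` factors), realised as usual as the
algebra of functions on `G ^ (n+1)` generated by the functions of one coordinate; it is the linear
span of the elementary tensors `f₀(t₀) ⋯ fₙ(tₙ)`. -/
def algTensor : Subalgebra ℂ C(Fin (n + 1) → G, ℂ) :=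
  Algebra.adjoin ℂ {u | ∃ (i : Fin (n + 1)) (f : C(G, ℂ)), u = coordFun i f}

/-- The same algebra as a type of its own, to carry the Haagerup norm (and not the uniform norm). -/
def HTensor : Type _ := algTensor n G

instance : CommRing (HTensor n G) := inferInstanceAs (CommRing (algTensor n G))

instance : Algebra ℂ (HTensor n G) := inferInstanceAs (Algebra ℂ (algTensor n G))

variable {n G}

/-- The function on `G ^ (n+1)` given by an element of the algebraic tensor product. -/
def HTensor.val : HTensor n G →ₐ[ℂ] C(Fin (n + 1) → G, ℂ) := (algTensor n G).val

theorem HTensor.val_injective : Function.Injective (HTensor.val : HTensor n G →ₐ[ℂ] _) :=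
  Subtype.val_injective

theorem HTensor.exists_hBound (u : HTensor n G) : ∃ c, HBound u.val c := by
  obtain ⟨u, hu⟩ := u
  change ∃ c, HBound u c
  induction hu using Algebra.adjoin_induction with
  | mem u hu => obtain ⟨i, f, rfl⟩ := hu; exact HBound.coord i f
  | algebraMap z =>
    rw [Algebra.algebraMap_eq_smul_one]
    exact ⟨_, HBound.one.smul z⟩
  | add u v _ _ hu hv => obtain ⟨c, hc⟩ := hu; obtain ⟨d, hd⟩ := hv; exact ⟨_, hc.add hd⟩
  | mul u v _ _ hu hv => obtain ⟨c, hc⟩ := hu; obtain ⟨d, hd⟩ := hv; exact ⟨_, hc.mul hd⟩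

theorem haagerupNorm_smul_le (z : ℂ) (u : HTensor n G) :
    haagerupNorm (z • u.val) ≤ ‖z‖ * haagerupNorm u.val := by
  refine le_of_forall_pos_le_add fun ε hε => ?_
  have hz : 0 < ‖z‖ + 1 := by positivity
  obtain ⟨c, hc, h⟩ := exists_hBound_lt u.exists_hBound
    (lt_add_of_pos_right (haagerupNorm u.val) (div_pos hε hz))
  refine (h.smul z).haagerupNorm_le.trans ?_
  have h1 : ‖z‖ * (ε / (‖z‖ + 1)) ≤ ε := by
    rw [mul_div_assoc', div_le_iff₀ hz]
    nlinarith
  have h2 := mul_le_mul_of_nonneg_left hc.le (norm_nonneg z)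
  linarith

theorem haagerupNorm_add_le (u v : HTensor n G) :
    haagerupNorm (u.val + v.val) ≤ haagerupNorm u.val + haagerupNorm v.val := by
  refine le_of_forall_pos_le_add fun ε hε => ?_
  obtain ⟨c, hc, h⟩ := exists_hBound_lt u.exists_hBound
    (lt_add_of_pos_right (haagerupNorm u.val) (half_pos hε))
  obtain ⟨d, hd, h'⟩ := exists_hBound_lt v.exists_hBound
    (lt_add_of_pos_right (haagerupNorm v.val) (half_pos hε))
  refine (h.add h').haagerupNorm_le.trans ?_
  linarith

theorem haagerupNorm_mul_le (u v : HTensor n G) :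
    haagerupNorm (u.val * v.val) ≤ haagerupNorm u.val * haagerupNorm v.val := by
  refine le_of_forall_gt_imp_ge_of_dense fun e he => ?_
  have hlim : Filter.Tendsto
      (fun ε : ℝ => (haagerupNorm u.val + ε) * (haagerupNorm v.val + ε))
      (nhdsWithin 0 (Set.Ioi 0)) (nhds (haagerupNorm u.val * haagerupNorm v.val)) := by
    have : Continuous fun ε : ℝ => (haagerupNorm u.val + ε) * (haagerupNorm v.val + ε) := by
      fun_prop
    simpa using (this.tendsto 0).mono_left nhdsWithin_le_nhds
  obtain ⟨ε, hε, hε0⟩ := ((hlim.eventually (gt_mem_nhds he)).and self_mem_nhdsWithin).exists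
  have hε0 : 0 < ε := hε0
  obtain ⟨c, hc, h⟩ := exists_hBound_lt u.exists_hBound
    (lt_add_of_pos_right (haagerupNorm u.val) hε0)
  obtain ⟨d, hd, h'⟩ := exists_hBound_lt v.exists_hBound
    (lt_add_of_pos_right (haagerupNorm v.val) hε0)
  exact ((h.mul h').haagerupNorm_le.trans
    (mul_le_mul hc.le hd.le h'.nonneg (h.nonneg.trans hc.le))).trans hε.le

theorem norm_val_le (u : HTensor n G) : ‖u.val‖ ≤ haagerupNorm u.val := by
  rw [ContinuousMap.norm_le _ (haagerupNorm_nonneg _)]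
  intro t
  refine le_of_forall_gt fun d hd => ?_
  obtain ⟨c, hc, h⟩ := exists_hBound_lt u.exists_hBound hd
  exact (h.norm_apply_le t).trans_lt hc

variable (n G) in
/-- The Haagerup norm is an algebra norm on the algebraic tensor product. -/
def haagerupRingNorm : RingNorm (HTensor n G) where
  toFun u := haagerupNorm u.val
  map_zero' := le_antisymm (by rw [map_zero]; exact HBound.zero.haagerupNorm_le)
    (haagerupNorm_nonneg _)
  add_le' u v := by rw [map_add]; exact haagerupNorm_add_le u v
  neg' u := by
    have h : ∀ w : HTensor n G, haagerupNorm (-w).val ≤ haagerupNorm w.val := fun w => by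
      have := haagerupNorm_smul_le (-1) w
      rw [map_neg]
      simpa using this
    exact le_antisymm (h u) (by simpa using h (-u))
  mul_le' u v := by rw [map_mul]; exact haagerupNorm_mul_le u v
  eq_zero_of_map_eq_zero' u hu := by
    have h := norm_val_le u
    rw [hu] at h
    exact HTensor.val_injective (by rw [map_zero]; exact norm_le_zero_iff.1 h)

instance : NormedCommRing (HTensor n G) :=
  { RingNorm.toNormedRing (haagerupRingNorm n G), (inferInstance : CommRing (HTensor n G)) with }

theorem HTensor.norm_def (u : HTensor n G) : ‖u‖ = haagerupNorm u.val := rfl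

instance : NormedAlgebra ℂ (HTensor n G) where
  norm_smul_le z u := by
    rw [HTensor.norm_def, HTensor.norm_def, map_smul]
    exact haagerupNorm_smul_le z u

theorem HTensor.continuous_val :
    Continuous ((HTensor.val : HTensor n G →ₐ[ℂ] C(Fin (n + 1) → G, ℂ)) :
      HTensor n G →+* C(Fin (n + 1) → G, ℂ)) :=
  AddMonoidHomClass.continuous_of_bound _ 1 fun u => by
    rw [one_mul]; exact norm_val_le u

variable (n G) in
/-- The multidimensional Varopoulos algebra `Vⁿ(G)`: the `(n+1)`-fold Haagerup tensor product of
`C(G)`, i.e. the completion of the algebraic tensor product in the Haagerup norm. Mathlib makes it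
a commutative Banach algebra over `ℂ`. -/
abbrev V : Type _ := UniformSpace.Completion (HTensor n G)

/-- The continuous function on `G ^ (n+1)` given by `ω ∈ Vⁿ(G)`: the continuous extension of
`HTensor.val`. -/
def toFun : V n G →+* C(Fin (n + 1) → G, ℂ) :=
  UniformSpace.Completion.extensionHom
    ((HTensor.val : HTensor n G →ₐ[ℂ] C(Fin (n + 1) → G, ℂ)) :
      HTensor n G →+* C(Fin (n + 1) → G, ℂ)) HTensor.continuous_val

theorem toFun_coe (u : HTensor n G) : toFun (u : V n G) = u.val :=
  UniformSpace.Completion.extensionHom_coe _ _ u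

theorem toFun_algebraMap (z : ℂ) :
    toFun (algebraMap ℂ (V n G) z) = algebraMap ℂ C(Fin (n + 1) → G, ℂ) z := by
  have : algebraMap ℂ (V n G) z = ((algebraMap ℂ (HTensor n G) z : HTensor n G) : V n G) := rfl
  rw [this, toFun_coe]
  exact HTensor.val.commutes z

variable (n G) in
/-- `Vⁿ_inv(G)`: the elements `ω` of `Vⁿ(G)` with
`ω(x₁x, …, xₙ₊₁x) = ω(x₁, …, xₙ₊₁)` for all `x, x₁, …, xₙ₊₁ ∈ G`; it is a subalgebra. -/
def Vinv [Mul G] : Subalgebra ℂ (V n G) where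
  carrier := {ω | ∀ (x : G) (t : Fin (n + 1) → G), toFun ω t = toFun ω fun i => t i * x}
  mul_mem' := by
    intro a b ha hb x t
    simp only [map_mul, ContinuousMap.mul_apply]
    rw [ha x t, hb x t]
  add_mem' := by
    intro a b ha hb x t
    simp only [map_add, ContinuousMap.add_apply]
    rw [ha x t, hb x t]
  algebraMap_mem' := by
    intro z x t
    rw [toFun_algebraMap]
    rfl

end Algebra

end Varopoulos

end

/-! The principle behind all norm estimates is functoriality of the Haagerup norm: a linear
operation that replaces each matrix factor in `u = x₀ ⊙ ⋯ ⊙ xₙ` by one of no larger norm is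
contractive (`norm_le_of_haagerupMap`). Two such operations are used: diagonal right translation,
and sampling followed by interpolation.

Translation gives the map. For an algebraic tensor `u` the orbit `g ↦ diagTranslate g u` is norm
continuous and bounded by `‖u‖`, so its Bochner integral exists in the completion and has norm at
most `‖u‖`; the resulting contraction extends by density to `average`. Point evaluations are
continuous and linear, hence commute with the integral and give the stated formula
(`toFun_average`).

Interpolation gives uniqueness: `toFun` is injective on the completion (`toFun_injective`), which
does not follow from the density of the algebraic tensors alone. The maps `interpTensor n p y`
depend only on the values of a function at finitely many points, are contractive uniformly in the
partition of unity `p`, and can be chosen to approximate any given algebraic tensor. They therefore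
recover the norm of `ω` from `toFun ω`.

Once elements of `V n G` are known to be determined by their functions, the projection and module
properties become pointwise identities, which follow from left invariance and normalization of Haar
measure. -/

noncomputable section

namespace Varopoulos

/-! ### Factorizations as a continuous multilinear map -/

section Factorization

variable {n : ℕ} {G : Type*} [TopologicalSpace G] [CompactSpace G]

/-- The element of the algebraic tensor product given by a function in `algTensor`. -/
def HTensor.mk (u : C(Fin (n + 1) → G, ℂ)) (hu : u ∈ algTensor n G) : HTensor n G :=
  (⟨u, hu⟩ : algTensor n G)

@[simp]
theorem HTensor.val_mk (u : C(Fin (n + 1) → G, ℂ)) (hu : u ∈ algTensor n G) :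
    (HTensor.mk u hu).val = u := rfl

theorem HTensor.val_mem (u : HTensor n G) : u.val ∈ algTensor n G := u.2

theorem coordFun_mem_algTensor (i : Fin (n + 1)) (f : C(G, ℂ)) : coordFun i f ∈ algTensor n G :=
  Algebra.subset_adjoin ⟨i, f, rfl⟩

theorem list_prod_apply_mem {R A ι : Type*} [CommSemiring R] [Semiring A] [Algebra R A]
    [Fintype ι] [DecidableEq ι] (S : Subalgebra R A) (l : List (Matrix ι ι A))
    (h : ∀ M ∈ l, ∀ i j, M i j ∈ S) (i j : ι) : l.prod i j ∈ S := by
  induction l generalizing i j with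
  | nil =>
    rw [List.prod_nil, Matrix.one_apply]
    split_ifs
    exacts [S.one_mem, S.zero_mem]
  | cons M l ih =>
    rw [List.prod_cons, Matrix.mul_apply]
    exact S.sum_mem fun k _ => S.mul_mem (h M (by simp) _ _)
      (ih (fun N hN => h N (by simp [hN])) _ _)

/-- The function `t ↦ (x₀(t₀) x₁(t₁) ⋯ xₙ(tₙ))₀₀` for matrices `x₀, …, xₙ` over `C(G)`. -/
def haagerupFun (r : ℕ) (x : Fin (n + 1) → C(G, Matrix (Fin (r + 1)) (Fin (r + 1)) ℂ)) :
    C(Fin (n + 1) → G, ℂ) where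
  toFun t := (List.ofFn fun k => x k (t k)).prod 0 0
  continuous_toFun := by
    refine Continuous.matrix_elem ?_ 0 0
    simp only [List.ofFn_eq_map]
    exact continuous_list_prod _ fun k _ => (x k).continuous.comp (continuous_apply k)

theorem isHaagerupFactorization_haagerupFun (r : ℕ)
    (x : Fin (n + 1) → C(G, Matrix (Fin (r + 1)) (Fin (r + 1)) ℂ)) :
    IsHaagerupFactorization (haagerupFun r x) r x := fun _ => rfl

/-- The matrix product can be formed over the ring of functions on `G ^ (n+1)`, each factor having
one-coordinate functions as entries; an entry of the product is then a polynomial in these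
generators. -/
theorem haagerupFun_mem_algTensor (r : ℕ)
    (x : Fin (n + 1) → C(G, Matrix (Fin (r + 1)) (Fin (r + 1)) ℂ)) :
    haagerupFun r x ∈ algTensor n G := by
  let X : Fin (n + 1) → Matrix (Fin (r + 1)) (Fin (r + 1)) C(Fin (n + 1) → G, ℂ) :=
    fun k => Matrix.of fun i j => coordFun k ⟨fun s => x k s i j, (x k).continuous.matrix_elem i j⟩
  have h : haagerupFun r x = (List.ofFn X).prod 0 0 := by
    ext t
    -- Evaluation at `t` is a ring homomorphism, so applied entrywise it commutes with the matrix
    -- product and turns `X k` into `x k (t k)`.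
    let ev : C(Fin (n + 1) → G, ℂ) →+* ℂ := ContinuousMap.evalAlgHom ℂ ℂ t
    have h1 : ev ((List.ofFn X).prod 0 0) = (ev.mapMatrix (List.ofFn X).prod) 0 0 := rfl
    have h2 : ev.mapMatrix ∘ X = fun k => x k (t k) := rfl
    change _ = ev _
    rw [h1, map_list_prod, List.map_ofFn, h2]
    rfl
  rw [h]
  refine list_prod_apply_mem _ _ (fun M hM i j => ?_) _ _
  obtain ⟨k, rfl⟩ := (List.mem_ofFn' _ _).1 hM
  exact coordFun_mem_algTensor _ _

theorem norm_mk_haagerupFun_le (r : ℕ)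
    (x : Fin (n + 1) → C(G, Matrix (Fin (r + 1)) (Fin (r + 1)) ℂ)) :
    ‖HTensor.mk (haagerupFun r x) (haagerupFun_mem_algTensor r x)‖ ≤ ∏ k, ‖x k‖ :=
  csInf_le (haagerupNorm_bddBelow _) ⟨r, x, isHaagerupFactorization_haagerupFun r x, rfl⟩

/-- Transfers multilinearity from the product of scalar matrices to `haagerupMap`. -/
theorem haagerupFun_update_apply {r : ℕ} [DecidableEq (Fin (n + 1))]
    (x : Fin (n + 1) → C(G, Matrix (Fin (r + 1)) (Fin (r + 1)) ℂ)) (i : Fin (n + 1))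
    (y : C(G, Matrix (Fin (r + 1)) (Fin (r + 1)) ℂ)) (t : Fin (n + 1) → G) :
    haagerupFun r (Function.update x i y) t = MultilinearMap.mkPiAlgebraFin ℂ (n + 1) _
      (Function.update (fun k => x k (t k)) i (y (t i))) 0 0 := by
  rw [MultilinearMap.mkPiAlgebraFin_apply]
  change (List.ofFn fun k => Function.update x i y k (t k)).prod 0 0 = _
  refine congrArg (fun X : Fin (n + 1) → Matrix (Fin (r + 1)) (Fin (r + 1)) ℂ =>
    (List.ofFn X).prod 0 0) (funext fun k => ?_)
  exact Function.apply_update (fun k (f : C(G, Matrix (Fin (r + 1)) (Fin (r + 1)) ℂ)) => f (t k))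
    x i y k

variable (n G) in
/-- The tensor `x₀ ⊙ ⋯ ⊙ xₙ`, as a continuous multilinear map. -/
def haagerupMap (r : ℕ) : ContinuousMultilinearMap ℂ
    (fun _ : Fin (n + 1) => C(G, Matrix (Fin (r + 1)) (Fin (r + 1)) ℂ)) (HTensor n G) :=
  MultilinearMap.mkContinuous
    { toFun := fun x => HTensor.mk (haagerupFun r x) (haagerupFun_mem_algTensor r x)
      map_update_add' := fun x i y z => HTensor.val_injective <| by
        ext t
        simp only [map_add, HTensor.val_mk, ContinuousMap.add_apply, haagerupFun_update_apply,
          MultilinearMap.map_update_add, Matrix.add_apply]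
      map_update_smul' := fun x i c y => HTensor.val_injective <| by
        ext t
        simp only [map_smul, HTensor.val_mk, ContinuousMap.smul_apply, haagerupFun_update_apply,
          MultilinearMap.map_update_smul, Matrix.smul_apply] }
    1 fun x => by rw [one_mul]; exact norm_mk_haagerupFun_le r x

theorem haagerupMap_val_apply (r : ℕ)
    (x : Fin (n + 1) → C(G, Matrix (Fin (r + 1)) (Fin (r + 1)) ℂ)) (t : Fin (n + 1) → G) :
    (haagerupMap n G r x).val t = (List.ofFn fun k => x k (t k)).prod 0 0 := rfl

theorem norm_haagerupMap_le (r : ℕ)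
    (x : Fin (n + 1) → C(G, Matrix (Fin (r + 1)) (Fin (r + 1)) ℂ)) :
    ‖haagerupMap n G r x‖ ≤ ∏ k, ‖x k‖ := norm_mk_haagerupFun_le r x

/-- Near-optimal factorizations exist because the norm is an infimum over a nonempty set. The strict
bound by an arbitrary `d` is what lets contractivity hold with constant exactly one. -/
theorem exists_haagerupMap_eq_of_norm_lt (u : HTensor n G) {d : ℝ} (hd : ‖u‖ < d) :
    ∃ (r : ℕ) (x : Fin (n + 1) → C(G, Matrix (Fin (r + 1)) (Fin (r + 1)) ℂ)),
      haagerupMap n G r x = u ∧ ∏ k, ‖x k‖ < d := by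
  obtain ⟨c, hc, h⟩ := exists_hBound_lt u.exists_hBound hd
  obtain ⟨r, x, hx, hxc⟩ := h.exists_factorization
  exact ⟨r, x, HTensor.val_injective (ContinuousMap.ext fun t => (hx t).symm), hxc.trans_lt hc⟩

theorem exists_haagerupMap_eq (u : HTensor n G) :
    ∃ (r : ℕ) (x : Fin (n + 1) → C(G, Matrix (Fin (r + 1)) (Fin (r + 1)) ℂ)),
      haagerupMap n G r x = u :=
  let ⟨r, x, hx, _⟩ := exists_haagerupMap_eq_of_norm_lt u (lt_add_one _)
  ⟨r, x, hx⟩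

/-- A map acting on each matrix factor by contractions is a contraction. -/
theorem norm_le_of_haagerupMap {F : HTensor n G → HTensor n G}
    (h : ∀ (r : ℕ) (x : Fin (n + 1) → C(G, Matrix (Fin (r + 1)) (Fin (r + 1)) ℂ)),
      ∃ y : Fin (n + 1) → C(G, Matrix (Fin (r + 1)) (Fin (r + 1)) ℂ),
        F (haagerupMap n G r x) = haagerupMap n G r y ∧ ∀ k, ‖y k‖ ≤ ‖x k‖)
    (u : HTensor n G) : ‖F u‖ ≤ ‖u‖ := by
  refine le_of_forall_gt fun d hd => ?_
  obtain ⟨r, x, rfl, hx⟩ := exists_haagerupMap_eq_of_norm_lt u hd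
  obtain ⟨y, hy, hle⟩ := h r x
  rw [hy]
  exact ((norm_haagerupMap_le r y).trans
    (Finset.prod_le_prod (fun _ _ => norm_nonneg _) fun k _ => hle k)).trans_lt hx

end Factorization

/-! ### Interpolation and injectivity of `toFun` -/

section Injectivity

variable {n : ℕ} {G : Type*} [TopologicalSpace G] [CompactSpace G]

theorem toFun_smul (z : ℂ) (ω : V n G) : toFun (z • ω) = z • toFun ω := by
  rw [Algebra.smul_def, map_mul, toFun_algebraMap, ← Algebra.smul_def]

theorem continuous_toFun : Continuous (toFun : V n G →+* C(Fin (n + 1) → G, ℂ)) :=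
  UniformSpace.Completion.continuous_extension

variable (n G) in
/-- `toFun` as a continuous linear map. -/
def toFunL : V n G →L[ℂ] C(Fin (n + 1) → G, ℂ) where
  toFun := toFun
  map_add' := map_add toFun
  map_smul' := toFun_smul
  cont := continuous_toFun

/-- The elementary tensor `f₀ ⊗ ⋯ ⊗ fₙ`. -/
def elemTensor (f : Fin (n + 1) → C(G, ℂ)) : HTensor n G :=
  HTensor.mk (∏ k, coordFun k (f k))
    (Subalgebra.prod_mem _ fun k _ => coordFun_mem_algTensor k (f k))

theorem elemTensor_val_apply (f : Fin (n + 1) → C(G, ℂ)) (t : Fin (n + 1) → G) :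
    (elemTensor f).val t = ∏ k, f k (t k) := by
  simp [elemTensor, ContinuousMap.prod_apply, coordFun]

/-- Sampling at the points `y`, followed by interpolation by the functions `p`. -/
def interp {ι E : Type*} [Fintype ι] [NormedAddCommGroup E] [NormedSpace ℂ E]
    (p : ι → C(G, ℂ)) (y : ι → G) (f : C(G, E)) : C(G, E) :=
  ⟨fun s => ∑ i, p i s • f (y i), by fun_prop⟩

variable (n) in
/-- The `(n+1)`-fold tensor power of `interp p y`; it only involves the values of a function at
finitely many points. -/
def interpTensor {ι : Type*} [Fintype ι] (p : ι → C(G, ℂ)) (y : ι → G) :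
    C(Fin (n + 1) → G, ℂ) →L[ℂ] HTensor n G :=
  ∑ i : Fin (n + 1) → ι, (ContinuousMap.evalCLM ℂ fun k => y (i k)).smulRight
    (elemTensor fun k => p (i k))

theorem interpTensor_val_apply {ι : Type*} [Fintype ι] (p : ι → C(G, ℂ)) (y : ι → G)
    (u : C(Fin (n + 1) → G, ℂ)) (t : Fin (n + 1) → G) :
    (interpTensor n p y u).val t
      = ∑ i : Fin (n + 1) → ι, u (fun k => y (i k)) * ∏ k, p (i k) (t k) := by
  simp [interpTensor, ContinuousMap.sum_apply, elemTensor_val_apply, map_sum]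

/-- Interpolation acts factor by factor, so the functoriality principle applies to it. -/
theorem interpTensor_haagerupMap {ι : Type*} [Fintype ι] (p : ι → C(G, ℂ)) (y : ι → G) (r : ℕ)
    (x : Fin (n + 1) → C(G, Matrix (Fin (r + 1)) (Fin (r + 1)) ℂ)) :
    interpTensor n p y (haagerupMap n G r x).val
      = haagerupMap n G r fun k => interp p y (x k) := by
  classical
  refine HTensor.val_injective (ContinuousMap.ext fun t => ?_)
  rw [interpTensor_val_apply, haagerupMap_val_apply]
  -- Expanding the product of sums gives one term for each choice function `Fin (n + 1) → ι`,
  -- exactly the index set of `interpTensor`.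
  have h := (MultilinearMap.mkPiAlgebraFin ℂ (n + 1)
    (Matrix (Fin (r + 1)) (Fin (r + 1)) ℂ)).map_sum fun k i => p i (t k) • x k (y i)
  simp only [MultilinearMap.map_smul_univ, MultilinearMap.mkPiAlgebraFin_apply] at h
  change _ = (List.ofFn fun k => ∑ i, p i (t k) • x k (y i)).prod 0 0
  rw [h, Matrix.sum_apply]
  exact Finset.sum_congr rfl fun i _ => mul_comm _ _

/-- A finite partition of unity. -/
def IsPartition {ι : Type*} [Fintype ι] (p : ι → C(G, ℂ)) : Prop :=
  ∀ s, ∑ i, ‖p i s‖ = 1 ∧ ∑ i, p i s = 1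

/-- Each value is an average of values of `f` with weights of total modulus one. Allowing an
arbitrary `E` covers matrices of every size: interpolation is completely contractive. -/
theorem IsPartition.norm_interp_le {ι E : Type*} [Fintype ι] [NormedAddCommGroup E]
    [NormedSpace ℂ E] {p : ι → C(G, ℂ)} (hp : IsPartition p) (y : ι → G) (f : C(G, E)) :
    ‖interp p y f‖ ≤ ‖f‖ := by
  rw [ContinuousMap.norm_le _ (norm_nonneg _)]
  intro s
  calc ‖∑ i, p i s • f (y i)‖ ≤ ∑ i, ‖p i s‖ * ‖f‖ :=
        norm_sum_le_of_le _ fun i _ => by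
          rw [norm_smul]
          exact mul_le_mul_of_nonneg_left (f.norm_coe_le_norm _) (norm_nonneg _)
    _ = ‖f‖ := by rw [← Finset.sum_mul, (hp s).1, one_mul]

theorem IsPartition.norm_interpTensor_le {ι : Type*} [Fintype ι] {p : ι → C(G, ℂ)}
    (hp : IsPartition p) (y : ι → G) (u : HTensor n G) : ‖interpTensor n p y u.val‖ ≤ ‖u‖ :=
  norm_le_of_haagerupMap (F := fun u => interpTensor n p y u.val) (fun r x =>
    ⟨_, interpTensor_haagerupMap p y r x, fun k => hp.norm_interp_le y (x k)⟩) u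

theorem IsPartition.norm_interpTensor_toFun_le {ι : Type*} [Fintype ι] {p : ι → C(G, ℂ)}
    (hp : IsPartition p) (y : ι → G) (ω : V n G) : ‖interpTensor n p y (toFun ω)‖ ≤ ‖ω‖ := by
  induction ω using UniformSpace.Completion.induction_on with
  | hp =>
    have h := (interpTensor n p y).continuous.comp (continuous_toFun (n := n) (G := G))
    exact isClosed_le h.norm continuous_norm
  | ih u =>
    rw [toFun_coe, UniformSpace.Completion.norm_coe]
    exact hp.norm_interpTensor_le y u

/-- A partition of unity subordinate to a cover by sets on which the functions oscillate little
makes each interpolated value an average of nearby values. One partition serves the whole finite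
family. -/
theorem exists_isPartition_dist_interp_le [T2Space G] {κ E : Type*} [Fintype κ]
    [NormedAddCommGroup E] [NormedSpace ℂ E] (f : κ → C(G, E)) {δ : ℝ} (hδ : 0 < δ) :
    ∃ (T : Finset G) (p : T → C(G, ℂ)), IsPartition p ∧
      ∀ k, dist (interp p Subtype.val (f k)) (f k) ≤ δ := by
  -- Bundling the family into one map to a product with the sup metric makes a single cover control
  -- all its members.
  let F : G → κ → E := fun s k => f k s
  have hF : Continuous F := continuous_pi fun k => (f k).continuous
  let U : G → Set G := fun y => F ⁻¹' Metric.ball (F y) δ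
  have hUo : ∀ y, IsOpen (U y) := fun y => Metric.isOpen_ball.preimage hF
  obtain ⟨T, hT⟩ := isCompact_univ.elim_finite_subcover U hUo
    fun s _ => Set.mem_iUnion.2 ⟨s, Metric.mem_ball_self hδ⟩
  obtain ⟨q, hq⟩ := PartitionOfUnity.exists_isSubordinate isClosed_univ
    (fun i : T => U i) (fun i => hUo i) fun s hs => by simpa using hT hs
  have hsum : ∀ s, ∑ i, q i s = 1 := fun s => by
    rw [← finsum_eq_sum_of_fintype]; exact q.sum_eq_one (Set.mem_univ s)
  have hn : ∀ i s, ‖((q i s : ℝ) : ℂ)‖ = q i s := fun i s =>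
    Complex.norm_of_nonneg (q.nonneg i s)
  have hsumC : ∀ s, ∑ i, ((q i s : ℝ) : ℂ) = 1 := fun s => by exact_mod_cast hsum s
  refine ⟨T, fun i => ⟨fun s => ((q i s : ℝ) : ℂ), by fun_prop⟩,
    fun s => ⟨?_, hsumC s⟩, fun k => ?_⟩
  · simpa only [ContinuousMap.coe_mk, hn] using hsum s
  rw [ContinuousMap.dist_le hδ.le]
  intro s
  rw [dist_eq_norm]
  have e : (∑ i, ((q i s : ℝ) : ℂ) • f k i) - f k s
      = ∑ i, ((q i s : ℝ) : ℂ) • (f k i - f k s) := by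
    simp only [smul_sub, Finset.sum_sub_distrib, ← Finset.sum_smul, hsumC, one_smul]
  change ‖(∑ i, ((q i s : ℝ) : ℂ) • f k i) - f k s‖ ≤ δ
  rw [e]
  calc _ ≤ ∑ i, q i s * δ := norm_sum_le_of_le _ fun i _ => by
        rw [norm_smul, hn]
        by_cases h0 : q i s = 0
        · simp [h0]
        -- A nonzero weight places `s` in the support, hence in the set where all functions are
        -- `δ`-close to their values at the centre `i`.
        · have hs : s ∈ U i := hq i (subset_tsupport _ h0)
          refine mul_le_mul_of_nonneg_left ?_ (q.nonneg i s)
          rw [← dist_eq_norm, dist_comm]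
          exact (dist_le_pi_dist (F s) (F i) k).trans (Metric.mem_ball.1 hs).le
    _ = δ := by rw [← Finset.sum_mul, hsum, one_mul]

theorem exists_isPartition_norm_interpTensor_sub_lt [T2Space G] (u : HTensor n G) {ε : ℝ}
    (hε : 0 < ε) : ∃ (T : Finset G) (p : T → C(G, ℂ)), IsPartition p ∧
      ‖interpTensor n p Subtype.val u.val - u‖ < ε := by
  obtain ⟨r, x, rfl⟩ := exists_haagerupMap_eq u
  obtain ⟨δ, hδ, h⟩ := Metric.continuous_iff.1 (haagerupMap n G r).cont x ε hε
  obtain ⟨T, p, hp, hd⟩ := exists_isPartition_dist_interp_le x (half_pos hδ)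
  refine ⟨T, p, hp, ?_⟩
  rw [interpTensor_haagerupMap, ← dist_eq_norm]
  exact h _ (((dist_pi_le_iff (half_pos hδ).le).2 hd).trans_lt (half_lt_self hδ))

/-- An element of `Vⁿ(G)` is determined by the function that it defines. -/
theorem toFun_injective [T2Space G] :
    Function.Injective (toFun : V n G →+* C(Fin (n + 1) → G, ℂ)) := by
  rw [injective_iff_map_eq_zero]
  intro ω hω
  rw [← norm_le_zero_iff]
  refine le_of_forall_pos_le_add fun ε hε => ?_
  obtain ⟨u, hu⟩ := UniformSpace.Completion.denseRange_coe.exists_dist_lt ω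
    (div_pos hε three_pos)
  obtain ⟨T, p, hp, hpu⟩ := exists_isPartition_norm_interpTensor_sub_lt u
    (div_pos hε three_pos)
  -- As `toFun ω = 0`, the tensors `u` and `u - ω` have the same samples. The partition was chosen
  -- after `u`, so it matters that the bound is uniform in `p`.
  have h1 : ‖interpTensor n p Subtype.val u.val‖ ≤ ‖(u : V n G) - ω‖ := by
    have := hp.norm_interpTensor_toFun_le Subtype.val ((u : V n G) - ω)
    rwa [map_sub, hω, sub_zero, toFun_coe] at this
  rw [dist_comm, dist_eq_norm] at hu
  have h2 : ‖(u : V n G)‖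
      ≤ ‖interpTensor n p Subtype.val u.val‖ + ‖interpTensor n p Subtype.val u.val - u‖ := by
    rw [UniformSpace.Completion.norm_coe]
    exact norm_le_insert _ _
  have h3 : ‖ω‖ ≤ ‖(u : V n G)‖ + ‖(u : V n G) - ω‖ := norm_le_insert _ _
  linarith

end Injectivity

/-! ### Translation and averaging over the group -/

section Averaging

variable {n : ℕ} {G : Type*} [Group G] [TopologicalSpace G] [IsTopologicalGroup G]
  [CompactSpace G]

/-- The right translate `s ↦ f (s g)`. -/
def translate {E : Type*} [TopologicalSpace E] (g : G) (f : C(G, E)) : C(G, E) :=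
  f.comp ⟨fun s => s * g, continuous_mul_const g⟩

theorem norm_translate_le {E : Type*} [SeminormedAddCommGroup E] (g : G) (f : C(G, E)) :
    ‖translate g f‖ ≤ ‖f‖ :=
  (ContinuousMap.norm_le _ (norm_nonneg _)).2 fun s => f.norm_coe_le_norm (s * g)

/-- Currying the jointly continuous map `(g, s) ↦ f (s * g)`; for normed `E` this is continuity in
the uniform norm. -/
theorem continuous_translate {E : Type*} [TopologicalSpace E] (f : C(G, E)) :
    Continuous fun g => translate g f :=
  ContinuousMap.continuous_of_continuous_uncurry _
    (f.continuous.comp (continuous_snd.mul continuous_fst))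

/-- The diagonal right translation `t ↦ t g` of `G ^ (n+1)`. -/
def diagRight (n : ℕ) (g : G) : C(Fin (n + 1) → G, Fin (n + 1) → G) :=
  ⟨fun t i => t i * g, by fun_prop⟩

theorem haagerupMap_val_comp_diagRight (r : ℕ)
    (x : Fin (n + 1) → C(G, Matrix (Fin (r + 1)) (Fin (r + 1)) ℂ)) (g : G) :
    (haagerupMap n G r x).val.comp (diagRight n g)
      = (haagerupMap n G r fun k => translate g (x k)).val := rfl

/-- The diagonal right translation of an algebraic tensor. -/
def diagTranslate (g : G) : HTensor n G →ₗ[ℂ] HTensor n G where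
  toFun u := HTensor.mk (u.val.comp (diagRight n g)) <| by
    obtain ⟨r, x, rfl⟩ := exists_haagerupMap_eq u
    rw [haagerupMap_val_comp_diagRight]
    exact HTensor.val_mem _
  map_add' _ _ := HTensor.val_injective (by simp only [map_add, HTensor.val_mk]; rfl)
  map_smul' _ _ := HTensor.val_injective (by simp only [map_smul, HTensor.val_mk]; rfl)

theorem diagTranslate_haagerupMap (g : G) (r : ℕ)
    (x : Fin (n + 1) → C(G, Matrix (Fin (r + 1)) (Fin (r + 1)) ℂ)) :
    diagTranslate g (haagerupMap n G r x) = haagerupMap n G r fun k => translate g (x k) :=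
  HTensor.val_injective rfl

theorem norm_diagTranslate_le (g : G) (u : HTensor n G) : ‖diagTranslate g u‖ ≤ ‖u‖ :=
  norm_le_of_haagerupMap (F := diagTranslate g) (fun r x =>
    ⟨_, diagTranslate_haagerupMap g r x, fun k => norm_translate_le g (x k)⟩) u

/-- Continuity in the Haagerup norm, not merely the uniform one: for a fixed factorization it
follows from continuity of the multilinear map `haagerupMap`. -/
theorem continuous_diagTranslate (u : HTensor n G) : Continuous fun g : G => diagTranslate g u := by
  obtain ⟨r, x, rfl⟩ := exists_haagerupMap_eq u
  simp only [diagTranslate_haagerupMap]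
  exact (haagerupMap n G r).cont.comp (continuous_pi fun k => continuous_translate (x k))

variable [MeasurableSpace G] [BorelSpace G] (μ : Measure G) [IsProbabilityMeasure μ]

theorem integrable_of_continuous {E : Type*} [NormedAddCommGroup E] {f : G → E}
    (hf : Continuous f) : Integrable f μ :=
  hf.integrable_of_hasCompactSupport (HasCompactSupport.of_compactSpace f)

theorem integrable_diagTranslate (u : HTensor n G) :
    Integrable (fun g : G => (diagTranslate g u : V n G)) μ :=
  integrable_of_continuous μ
    ((UniformSpace.Completion.continuous_coe _).comp (continuous_diagTranslate u))

theorem norm_integral_diagTranslate_le (u : HTensor n G) :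
    ‖∫ g, (diagTranslate g u : V n G) ∂μ‖ ≤ ‖u‖ := by
  have h := norm_integral_le_of_norm_le_const (μ := μ) (C := ‖u‖)
    (f := fun g : G => (diagTranslate g u : V n G))
    (Filter.Eventually.of_forall fun g => by
      rw [UniformSpace.Completion.norm_coe]; exact norm_diagTranslate_le g u)
  simpa using h

/-- The average over all diagonal right translates of an algebraic tensor. -/
def averageTensor : HTensor n G →L[ℂ] V n G :=
  LinearMap.mkContinuous
    -- The integrand is first moved to the completion: in a space that is not complete the Bochner
    -- integral is zero by convention.
    { toFun := fun u => ∫ g, (diagTranslate g u : V n G) ∂μ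
      map_add' := fun u v => by
        simp only [map_add, UniformSpace.Completion.coe_add]
        exact integral_add (integrable_diagTranslate μ u) (integrable_diagTranslate μ v)
      map_smul' := fun z u => by
        simp only [map_smul, UniformSpace.Completion.coe_smul, RingHom.id_apply]
        exact integral_smul z _ }
    1 fun u => by rw [one_mul]; exact norm_integral_diagTranslate_le μ u

/-- The averaging map on `Vⁿ(G)`. -/
def average : V n G →L[ℂ] V n G :=
  (averageTensor μ).extend UniformSpace.Completion.toComplL

theorem average_coe (u : HTensor n G) :
    average μ (u : V n G) = ∫ g, (diagTranslate g u : V n G) ∂μ :=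
  ContinuousLinearMap.extend_eq (averageTensor μ) UniformSpace.Completion.denseRange_coe
    (UniformSpace.Completion.isUniformInducing_coe _) u

theorem norm_average_le (ω : V n G) : ‖average μ ω‖ ≤ ‖ω‖ := by
  induction ω using UniformSpace.Completion.induction_on with
  | hp => exact isClosed_le (average μ).continuous.norm continuous_norm
  | ih u =>
    rw [average_coe, UniformSpace.Completion.norm_coe]
    exact norm_integral_diagTranslate_le μ u

theorem continuous_comp_mul_right (f : C(Fin (n + 1) → G, ℂ)) (t : Fin (n + 1) → G) :
    Continuous fun g => f fun i => t i * g := by fun_prop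

/-- Averaging over the diagonal right translates of a point, as a functional on functions. -/
def averageAt (t : Fin (n + 1) → G) : C(Fin (n + 1) → G, ℂ) →L[ℂ] ℂ :=
  LinearMap.mkContinuous
    { toFun := fun f => ∫ g, f (fun i => t i * g) ∂μ
      map_add' := fun f h => integral_add (integrable_of_continuous μ
        (continuous_comp_mul_right f t)) (integrable_of_continuous μ
        (continuous_comp_mul_right h t))
      map_smul' := fun z f => integral_smul z _ }
    1 fun f => by
      have h := norm_integral_le_of_norm_le_const (μ := μ) (C := ‖f‖)
        (f := fun g : G => f fun i => t i * g)
        (Filter.Eventually.of_forall fun g => f.norm_coe_le_norm _)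
      simpa using h

theorem toFun_average (ω : V n G) (t : Fin (n + 1) → G) :
    toFun (average μ ω) t = ∫ g, toFun ω (fun i => t i * g) ∂μ := by
  let ev : V n G →L[ℂ] ℂ := (ContinuousMap.evalCLM ℂ t).comp (toFunL n G)
  change ev (average μ ω) = averageAt μ t (toFunL n G ω)
  induction ω using UniformSpace.Completion.induction_on with
  -- Both sides are continuous in `ω`, so algebraic tensors suffice; there the functional `ev`
  -- passes under the Bochner integral.
  | hp => exact isClosed_eq (by fun_prop) (by fun_prop)
  | ih u =>
    rw [average_coe, ← ev.integral_comp_comm (integrable_diagTranslate μ u)]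
    change ∫ g, toFun (diagTranslate g u : V n G) t ∂μ = ∫ g, toFun (u : V n G) _ ∂μ
    simp only [toFun_coe]
    rfl

end Averaging

end Varopoulos

end

theorem mainTheorem7 (n : ℕ) (G : Type*) [Group G] [TopologicalSpace G] [IsTopologicalGroup G]
    [CompactSpace G] [T2Space G] [MeasurableSpace G] [BorelSpace G]
    (μ : Measure G) [μ.IsHaarMeasure] [IsProbabilityMeasure μ] :
    ∃ P : Varopoulos.V n G →L[ℂ] Varopoulos.V n G,
      -- `P` is the averaging map, and it is the only map given by the formula
      (∀ (ω : Varopoulos.V n G) (t : Fin (n + 1) → G),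
        Varopoulos.toFun (P ω) t = ∫ x, Varopoulos.toFun ω (fun i => t i * x) ∂μ) ∧
      (∀ ω η : Varopoulos.V n G,
        (∀ t : Fin (n + 1) → G,
          Varopoulos.toFun η t = ∫ x, Varopoulos.toFun ω (fun i => t i * x) ∂μ) → η = P ω) ∧
      -- `P` is contractive
      (∀ ω : Varopoulos.V n G, ‖P ω‖ ≤ ‖ω‖) ∧
      -- `P` is a projection with range `Vⁿ_inv(G)`
      (∀ ω : Varopoulos.V n G, P (P ω) = P ω) ∧
      Set.range P = (Varopoulos.Vinv n G : Set (Varopoulos.V n G)) ∧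
      -- `P` is a `Vⁿ_inv(G)`-module map
      (∀ v ∈ Varopoulos.Vinv n G, ∀ ω : Varopoulos.V n G, P (v * ω) = v * P ω) := by
  have formula := Varopoulos.toFun_average (n := n) μ
  have ext_toFun : ∀ ω η : Varopoulos.V n G,
      (∀ t, Varopoulos.toFun ω t = Varopoulos.toFun η t) → ω = η :=
    fun ω η h => Varopoulos.toFun_injective (ContinuousMap.ext h)
  have mem_inv : ∀ ω, Varopoulos.average μ ω ∈ Varopoulos.Vinv n G := by
    intro ω y t
    rw [formula, formula]
    simp only [mul_assoc]
    -- Right translation of the arguments by `y` becomes left translation `x ↦ y * x` of the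
    -- integration variable, so left invariance of `μ` is the one required.
    exact (integral_mul_left_eq_self (fun x => Varopoulos.toFun ω fun i => t i * x) y).symm
  have fixed : ∀ ω ∈ Varopoulos.Vinv n G, Varopoulos.average μ ω = ω := by
    intro ω hω
    refine ext_toFun _ _ fun t => ?_
    rw [formula]
    have h : ∀ x : G, Varopoulos.toFun ω (fun i => t i * x) = Varopoulos.toFun ω t :=
      fun x => (hω x t).symm
    -- The integrand is constant and `μ` has total mass one.
    simp [h]
  refine ⟨Varopoulos.average μ, formula, fun ω η h => ext_toFun _ _ fun t => ?_,
    Varopoulos.norm_average_le μ, fun ω => fixed _ (mem_inv ω), ?_, fun v hv ω => ?_⟩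
  · rw [h, formula]
  · ext ω
    exact ⟨fun ⟨η, h⟩ => h ▸ mem_inv η, fun h => ⟨ω, fixed ω h⟩⟩
  · refine ext_toFun _ _ fun t => ?_
    -- The factor `v` is constant along the orbit `x ↦ t x`, so it can be taken inside the integral
    -- as a scalar.
    rw [formula, map_mul, map_mul, ContinuousMap.mul_apply, formula, ← integral_const_mul]
    refine integral_congr_ae (Filter.Eventually.of_forall fun x => ?_)
    simp only [ContinuousMap.mul_apply]
    rw [← hv x t]
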